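/- **Notation.** $\mathbb{B}$ denotes the closed Euclidean unit ball, $\operatorname{dist}$ the Euclidean point-to-set distance (with $\operatorname{dist}(\cdot;\emptyset)=\infty$). For $\Omega\subset\mathbb{R}^d$ and $z\in\Omega$ let $$T_\Omega(z)=\{u\mid \exists\,t_k\downarrow 0,\ u_k\to u:\ z+t_ku_k\in\Omega\ \forall k\},\qquad \widehat N_\Omega(z)=\{v\mid \langle v,u\rangle\le 0\ \forall u\in T_\Omega(z)\},$$ $$N_\Omega(z)=\{v\mid \exists\,z_k\to z,\ v_k\to v:\ z_k\in\Omega,\ v_k\in\widehat N_\Omega(z_k)\ \forall k\}.$$ A set-valued mapping $F$ is *metrically subregular* at a point $(\bar x,\bar y)$ of its graph with modulus $\kappa\ge 0$ if $\operatorname{dist}(x;F^{-1}(\bar y))\le\kappa\operatorname{dist}(\bar y;F(x))$ for all $x$ in some neighborhood of $\bar x$; the infimum of all such moduli $\kappa$ is the *exact subregularity bound* $\operatorname{subreg}F(\bar x,\bar y)$. A set $C\subset\mathbb{R}^l$ is *subamenable* at $\bar z\in C$ if there are a neighborhood $W$ of $\bar z$, a $C^1$ mapping $q\colon W\to\mathbb{R}^d$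 for some $d\in\mathbb{N}$, and a closed convex set $Q\subset\mathbb{R}^d$ such that $C\cap W=\{z\in W\mid q(z)\in Q\}$ and the mapping $z\mapsto q(z)-Q$ is metrically subregular at $(\bar z,0)$. **Corollary 3.4 (calculating the exact subregularity bound).** Let $f\colon\mathbb{R}^n\to\mathbb{R}^l$ be continuously differentiable, let $C\subset\mathbb{R}^l$ be subamenable at $f(\bar x)\in C$, and let the mapping $x\mapsto F(x):=f(x)-C$ be metrically subregular at $(\bar x,0)$. Then $$\begin{aligned} \operatorname{subreg}F(\bar x,0)&=\limsup_{x\to\bar x,\ x\in f^{-1}(C)}\ \sup_{v\in N_{f^{-1}(C)}(x)\cap\mathbb{B}}\ \inf\{\|\lambda\|\mid \lambda\in N_C(f(x)),\ \nabla f(x)^*\lambda=v\}\\ &=\limsup_{x\to\bar x,\ x\in f^{-1}(C)}\ \inf\{\tau\ge 0\mid N_{f^{-1}(C)}(x)\cap\mathbb{B}\subset\tau\,\nabla f(x)^*(N_C(f(x))\cap\mathbb{B})\}\\ &=\limsup_{x\to\bar x,\ x\in f^{-1}(C)}\ \inf\{\tau\ge 0\mid N_{f^{-1}(C)}(x)\cap\mathbb{B}\subset\tau\,D^*F(x,0)(\mathbb{B})\},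 \end{aligned}$$ where $D^*F(x,0)(\lambda):=\{\nabla f(x)^*\lambda\}$ if $\lambda\in N_C(f(x))$ and $D^*F(x,0)(\lambda):=\emptyset$ otherwise, and $D^*F(x,0)(\mathbb{B}):=\bigcup_{\lambda\in\mathbb{B}}D^*F(x,0)(\lambda)$. Suprema, infima and upper limits are taken in $[0,\infty]$ (so $\inf\emptyset=\infty$), and $x=\bar x$ is admitted in the upper limits. -/

import Mathlib

open Set Filter Topology
open scoped Pointwise NNReal ENNReal

noncomputable section

/-! ### Tangents and normals -/

/-- The Bouligand-Severi contingent cone `T_Ω(z)`. -/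
def contingentCone {E : Type*} [NormedAddCommGroup E] [InnerProductSpace ℝ E]
    (Ω : Set E) (z : E) : Set E :=
  {u | ∃ (t : ℕ → ℝ) (w : ℕ → E), (∀ k, 0 < t k) ∧ Tendsto t atTop (𝓝 0) ∧
    Tendsto w atTop (𝓝 u) ∧ ∀ k, z + t k • w k ∈ Ω}

/-- The Fréchet regular normal cone, i.e. the polar of the contingent cone. -/
def regularNormalCone {E : Type*} [NormedAddCommGroup E] [InnerProductSpace ℝ E]
    (Ω : Set E) (z : E) : Set E :=
  {v | ∀ u ∈ contingentCone Ω z, inner ℝ v u ≤ 0}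

/-- The Mordukhovich limiting normal cone `N_Ω(z)` (used at points `z ∈ Ω` only). -/
def limitingNormalCone {E : Type*} [NormedAddCommGroup E] [InnerProductSpace ℝ E]
    (Ω : Set E) (z : E) : Set E :=
  {v | ∃ (ζ : ℕ → E) (w : ℕ → E), Tendsto ζ atTop (𝓝 z) ∧ Tendsto w atTop (𝓝 v) ∧
    ∀ k, ζ k ∈ Ω ∧ w k ∈ regularNormalCone Ω (ζ k)}

/-! ### Metric subregularity of set-valued mappings -/

/-- `κ ≥ 0` is a modulus of metric subregularity of the set-valued mapping `F` at `(x₀, y₀)`: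
`dist(x; F⁻¹(y₀)) ≤ κ dist(y₀; F(x))` for all `x` in a neighborhood of `x₀`.
The distance to the empty set is `∞`. -/
def IsSubregularityModulus {X Y : Type*} [PseudoEMetricSpace X] [PseudoEMetricSpace Y]
    (F : X → Set Y) (x₀ : X) (y₀ : Y) (κ : ℝ≥0) : Prop :=
  ∃ U ∈ 𝓝 x₀, ∀ x ∈ U,
    Metric.infEDist x {x' | y₀ ∈ F x'} ≤ (κ : ℝ≥0∞) * Metric.infEDist y₀ (F x)

/-- The set-valued mapping `F` is metrically subregular at `(x₀, y₀)`, a point of its graph. -/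
def MetricallySubregularAt {X Y : Type*} [PseudoEMetricSpace X] [PseudoEMetricSpace Y]
    (F : X → Set Y) (x₀ : X) (y₀ : Y) : Prop :=
  y₀ ∈ F x₀ ∧ ∃ κ : ℝ≥0, IsSubregularityModulus F x₀ y₀ κ

/-- The exact subregularity bound `subreg F(x₀, y₀)`: the infimum of all moduli of metric
subregularity (`∞` if there are none). -/
def subregBound {X Y : Type*} [PseudoEMetricSpace X] [PseudoEMetricSpace Y]
    (F : X → Set Y) (x₀ : X) (y₀ : Y) : ℝ≥0∞ :=
  ⨅ (κ : ℝ≥0) (_ : IsSubregularityModulus F x₀ y₀ κ), (κ : ℝ≥0∞)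

/-- The set-valued mapping `x ↦ f(x) - C`. -/
def constraintMap {X Y : Type*} [AddCommGroup Y] (f : X → Y) (C : Set Y) (x : X) : Set Y :=
  {y | ∃ c ∈ C, y = f x - c}

/-- The set `C ⊆ ℝˡ` is subamenable at `z₀ ∈ C`. The mapping `q` is defined on the neighborhood
`W`, so that the set-valued mapping `z ↦ q(z) - Q` has empty values outside `W`. The neighborhood
is taken open, as one may always shrink it. -/
def SubamenableAt {l : ℕ} (C : Set (EuclideanSpace ℝ (Fin l))) (z₀ : EuclideanSpace ℝ (Fin l)) :
    Prop :=
  z₀ ∈ C ∧ ∃ (W : Set (EuclideanSpace ℝ (Fin l))) (d : ℕ)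
    (q : EuclideanSpace ℝ (Fin l) → EuclideanSpace ℝ (Fin d))
    (Q : Set (EuclideanSpace ℝ (Fin d))),
    IsOpen W ∧ z₀ ∈ W ∧ ContDiffOn ℝ 1 q W ∧ IsClosed Q ∧ Convex ℝ Q ∧
    C ∩ W = {z | z ∈ W ∧ q z ∈ Q} ∧
    MetricallySubregularAt (fun z => {y | z ∈ W ∧ y ∈ constraintMap q Q z}) z₀ 0

/-! ### Adjoint derivative and coderivative -/

/-- `∇f(x)*`, the adjoint (transpose) of the derivative of `f` at `x`. -/
def adjointDeriv {n l : ℕ} (f : EuclideanSpace ℝ (Fin n) → EuclideanSpace ℝ (Fin l))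
    (x : EuclideanSpace ℝ (Fin n)) : EuclideanSpace ℝ (Fin l) →L[ℝ] EuclideanSpace ℝ (Fin n) :=
  ContinuousLinearMap.adjoint (fderiv ℝ f x)

/-- The coderivative `D*F(x,0)` of `F = f(·) - C`: its value at `u` is `{∇f(x)* u}` if
`u ∈ N_C(f(x))`, and it is empty otherwise. -/
def constraintCoderiv {n l : ℕ} (f : EuclideanSpace ℝ (Fin n) → EuclideanSpace ℝ (Fin l))
    (C : Set (EuclideanSpace ℝ (Fin l))) (x : EuclideanSpace ℝ (Fin n))
    (u : EuclideanSpace ℝ (Fin l)) : Set (EuclideanSpace ℝ (Fin n)) :=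
  {v | u ∈ limitingNormalCone C (f x) ∧ v = adjointDeriv f x u}

end

/-! ### Tangent and normal cones: first-order calculus. -/

section Normals

variable {E G : Type*} [NormedAddCommGroup E] [InnerProductSpace ℝ E]
  [NormedAddCommGroup G] [InnerProductSpace ℝ G]

/-! The core is that moduli of subregularity and uniform bounds on multipliers of unit normals to `f
⁻¹' C` control each other near the reference point (`subregBound_eq_limsup`).

From modulus to multipliers (`exists_multiplier`): a regular normal `v` makes the base point a local
minimizer of `-⟨v, ·⟩` plus a multiple of the distance to the constraint set plus a small linear
term. Subregularity replaces the distance by `κ‖g x - y‖` with `y ∈ D` as an extra variable.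
Stationarity in `y` produces a normal to `D`, stationarity in `x` the approximate multiplier
equation; compactness passes to the limit. Only local closedness of the target set is needed.

From multipliers to modulus (`isSubregularityModulus_of_multipliers`): let `u` be a nearest feasible
point to `x` and `w` a multiplier of the unit vector along `x - u`. Then `‖x - u‖` is, up to
linearization error, `⟨w, f x - c⟩ + ⟨w, c - f u⟩`. The first term is at most `τ‖f x - c‖`; the
second is negligible because `C` is super-regular (`SubamenableAt.exists_inner_le`), which follows
by applying `exists_multiplier` to `q` and the convex set `Q`. Hence every `κ > τ` is a modulus.

The other two formulas agree with the first pointwise in `x`, because normals form a cone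
(`iSup_iInf_enorm_eq_iInf_subset`). -/

/-- First order necessary condition for approximate local minimizers over a set. -/
theorem nonneg_fderiv_add_of_approx_min {D : Set E} {a : E} {φ : E → ℝ} {φ' : E →L[ℝ] ℝ} {ε : ℝ}
    (hφ : HasFDerivAt φ φ' a) (hmin : ∀ᶠ y in 𝓝[D] a, φ a ≤ φ y + ε * ‖y - a‖)
    {u : E} (hu : u ∈ contingentCone D a) : 0 ≤ φ' u + ε * ‖u‖ := by
  obtain ⟨t, w, ht, ht0, hw, hmem⟩ := hu
  have htw : Tendsto (fun k => t k • w k) atTop (𝓝 0) := by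
    simpa using ht0.smul hw
  have hcd : Tendsto (fun k => (t k)⁻¹ • (t k • w k)) atTop (𝓝 u) := by
    refine hw.congr fun k => ?_
    rw [smul_smul, inv_mul_cancel₀ (ht k).ne', one_smul]
  have hlim := (hasFDerivWithinAt_univ.2 hφ).lim htw (Eventually.of_forall fun k => mem_univ _) hcd
  have hadd : Tendsto (fun k => a + t k • w k) atTop (𝓝[D] a) := by
    refine tendsto_nhdsWithin_iff.2 ⟨?_, Eventually.of_forall hmem⟩
    simpa using htw.const_add a
  refine ge_of_tendsto (hlim.add (hw.norm.const_mul ε)) ?_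
  filter_upwards [hadd.eventually hmin] with k hk
  have hn : ‖a + t k • w k - a‖ = t k * ‖w k‖ := by
    rw [add_sub_cancel_left, norm_smul, Real.norm_of_nonneg (ht k).le]
  rw [hn] at hk
  have h2 : (t k)⁻¹ • (φ (a + t k • w k) - φ a) + ε * ‖w k‖
      = (t k)⁻¹ * (φ (a + t k • w k) + ε * (t k * ‖w k‖) - φ a) := by
    have := (ht k).ne'
    simp only [smul_eq_mul]
    field_simp
    ring
  rw [h2]
  exact mul_nonneg (inv_nonneg.2 (ht k).le) (by linarith)

theorem mem_contingentCone_univ (a u : E) : u ∈ contingentCone univ a :=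
  ⟨fun k => 1 / ((k : ℝ) + 1), fun _ => u, fun k => by positivity,
    tendsto_one_div_add_atTop_nhds_zero_nat, tendsto_const_nhds, fun _ => mem_univ _⟩

/-- Every direction is tangent to the whole space, so the one-sided estimate applies to both `u` and
`-u`. -/
theorem norm_fderiv_le_of_approx_min {a : E} {φ : E → ℝ} {φ' : E →L[ℝ] ℝ} {ε : ℝ} (hε : 0 ≤ ε)
    (hφ : HasFDerivAt φ φ' a) (hmin : ∀ᶠ y in 𝓝 a, φ a ≤ φ y + ε * ‖y - a‖) : ‖φ'‖ ≤ ε := by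
  rw [← nhdsWithin_univ] at hmin
  refine φ'.opNorm_le_bound hε fun u => ?_
  have h1 := nonneg_fderiv_add_of_approx_min hφ hmin (mem_contingentCone_univ a u)
  have h2 := nonneg_fderiv_add_of_approx_min hφ hmin (mem_contingentCone_univ a (-u))
  rw [map_neg, norm_neg] at h2
  rw [Real.norm_eq_abs, abs_le]
  constructor <;> linarith

theorem mem_regularNormalCone_of_min {D : Set E} {a v : E} {φ : E → ℝ}
    (hφ : HasFDerivAt φ (-innerSL ℝ v) a) (hmin : ∀ᶠ y in 𝓝[D] a, φ a ≤ φ y) :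
    v ∈ regularNormalCone D a := by
  intro u hu
  have := nonneg_fderiv_add_of_approx_min (ε := 0) hφ (by simpa using hmin) hu
  simp only [neg_apply, innerSL_apply_apply, zero_mul, add_zero] at this
  linarith

theorem smul_mem_regularNormalCone {D : Set E} {a v : E} (hv : v ∈ regularNormalCone D a)
    {t : ℝ} (ht : 0 ≤ t) : t • v ∈ regularNormalCone D a := fun u hu => by
  rw [real_inner_smul_left]
  exact mul_nonpos_of_nonneg_of_nonpos ht (hv u hu)

theorem smul_mem_limitingNormalCone {D : Set E} {a v : E} (hv : v ∈ limitingNormalCone D a)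
    {t : ℝ} (ht : 0 ≤ t) : t • v ∈ limitingNormalCone D a := by
  obtain ⟨ζ, w, hζ, hw, h⟩ := hv
  exact ⟨ζ, fun k => t • w k, hζ, hw.const_smul t,
    fun k => ⟨(h k).1, smul_mem_regularNormalCone (h k).2 ht⟩⟩

theorem regularNormalCone_subset_limitingNormalCone {D : Set E} {a : E} (ha : a ∈ D) :
    regularNormalCone D a ⊆ limitingNormalCone D a := fun v hv =>
  ⟨fun _ => a, fun _ => v, tendsto_const_nhds, tendsto_const_nhds, fun _ => ⟨ha, hv⟩⟩

/-- Writing the graph as a closure gives stability under limits without a diagonal sequence. -/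
theorem mem_limitingNormalCone_iff {D : Set E} {a v : E} :
    v ∈ limitingNormalCone D a ↔
      (a, v) ∈ closure {p : E × E | p.1 ∈ D ∧ p.2 ∈ regularNormalCone D p.1} := by
  rw [mem_closure_iff_seq_limit]
  constructor
  · rintro ⟨ζ, w, hζ, hw, h⟩
    exact ⟨fun k => (ζ k, w k), h, hζ.prodMk_nhds hw⟩
  · rintro ⟨p, hp, hlim⟩
    exact ⟨fun k => (p k).1, fun k => (p k).2, (continuous_fst.tendsto _).comp hlim,
      (continuous_snd.tendsto _).comp hlim, hp⟩

/-- The graph of the limiting normal cone mapping is closed. -/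
theorem mem_limitingNormalCone_of_tendsto {D : Set E} {a v : E} {ζ w : ℕ → E}
    (hζ : Tendsto ζ atTop (𝓝 a)) (hw : Tendsto w atTop (𝓝 v))
    (h : ∀ᶠ k in atTop, w k ∈ limitingNormalCone D (ζ k)) : v ∈ limitingNormalCone D a := by
  rw [mem_limitingNormalCone_iff]
  refine isClosed_closure.mem_of_tendsto (hζ.prodMk_nhds hw) ?_
  filter_upwards [h] with k hk using mem_limitingNormalCone_iff.1 hk

/-- Regular normals satisfy the Fréchet inequality. -/
theorem eventually_inner_le_of_mem_regularNormalCone [FiniteDimensional ℝ E] {D : Set E} {a v : E}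
    (hv : v ∈ regularNormalCone D a) {ε : ℝ} (hε : 0 < ε) :
    ∀ᶠ y in 𝓝[D] a, inner ℝ v (y - a) ≤ ε * ‖y - a‖ := by
  -- Normalizing a violating sequence and using compactness of the sphere gives a tangent direction
  -- `u` with `⟨v, u⟩ ≥ ε`.
  by_contra hcon
  have hfr : ∃ᶠ y in 𝓝[D] a, ε * ‖y - a‖ < inner ℝ v (y - a) := by
    simpa only [Filter.Frequently, not_lt] using hcon
  obtain ⟨y, hy, hlt⟩ := exists_seq_forall_of_frequently hfr
  rw [tendsto_nhdsWithin_iff] at hy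
  obtain ⟨hya, hyD⟩ := hy
  obtain ⟨N, hN⟩ := eventually_atTop.1 hyD
  have hpos : ∀ k, 0 < ‖y k - a‖ := fun k => by
    rw [norm_pos_iff]
    intro h0
    simpa [h0] using hlt k
  set w : ℕ → E := fun k => ‖y k - a‖⁻¹ • (y k - a) with hw
  have hwn : ∀ k, w k ∈ Metric.sphere (0 : E) 1 := fun k => by
    rw [mem_sphere_zero_iff_norm, hw, norm_smul, norm_inv, norm_norm,
      inv_mul_cancel₀ (hpos k).ne']
  obtain ⟨u, -, φ, hφ, hlim⟩ := (isCompact_sphere (0 : E) 1).tendsto_subseq hwn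
  have hnorm : Tendsto (fun k => ‖y k - a‖) atTop (𝓝 0) := by
    simpa using (hya.sub_const a).norm
  have huT : u ∈ contingentCone D a := by
    -- The shift by `N` discards the finitely many terms possibly outside `D`.
    refine ⟨fun k => ‖y (φ (k + N)) - a‖, fun k => w (φ (k + N)), fun k => hpos _, ?_, ?_, ?_⟩
    · exact hnorm.comp (hφ.tendsto_atTop.comp (tendsto_add_atTop_nat N))
    · exact hlim.comp (tendsto_add_atTop_nat N)
    · intro k
      have h1 : a + ‖y (φ (k + N)) - a‖ • w (φ (k + N)) = y (φ (k + N)) := by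
        rw [hw]
        simp only
        rw [smul_smul, mul_inv_cancel₀ (hpos _).ne', one_smul, add_sub_cancel]
      rw [h1]
      exact hN _ ((Nat.le_add_left N k).trans (hφ.le_apply))
  have hle : ε ≤ inner ℝ v u := by
    refine ge_of_tendsto ((continuous_const.inner continuous_id).tendsto u |>.comp hlim)
      (Eventually.of_forall fun k => ?_)
    have := hlt (φ k)
    simp only [Function.comp, id, hw, real_inner_smul_right]
    rw [inv_mul_eq_div, le_div_iff₀ (hpos _)]
    exact this.le
  linarith [hv u huT]

/-- Limits of multipliers are multipliers. -/
theorem exists_multiplier_of_tendsto [FiniteDimensional ℝ E] {D : Set E} {y : E} {v : G}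
    {ζ w : ℕ → E} {A : ℕ → E →L[ℝ] G} {A₀ : E →L[ℝ] G} {ρ : ℕ → ℝ} {r : ℝ}
    (hζ : Tendsto ζ atTop (𝓝 y)) (hA : Tendsto A atTop (𝓝 A₀))
    (hv : Tendsto (fun k => A k (w k)) atTop (𝓝 v)) (hρ : Tendsto ρ atTop (𝓝 r))
    (hw : ∀ᶠ k in atTop, ‖w k‖ ≤ ρ k)
    (h : ∀ᶠ k in atTop, w k ∈ limitingNormalCone D (ζ k)) :
    ∃ u ∈ limitingNormalCone D y, ‖u‖ ≤ r ∧ A₀ u = v := by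
  have hbd : ∃ᶠ k in atTop, w k ∈ Metric.closedBall (0 : E) (r + 1) := by
    refine Eventually.frequently ?_
    filter_upwards [hw, hρ.eventually (gt_mem_nhds (lt_add_one r))] with k h1 h2
    rw [mem_closedBall_zero_iff]
    linarith
  obtain ⟨u, -, φ, hφ, hlim⟩ :=
    (isCompact_closedBall (0 : E) (r + 1)).tendsto_subseq' hbd
  have hφt := hφ.tendsto_atTop
  refine ⟨u, mem_limitingNormalCone_of_tendsto (hζ.comp hφt) hlim (hφt.eventually h), ?_, ?_⟩
  · exact le_of_tendsto_of_tendsto hlim.norm (hρ.comp hφt) (hφt.eventually hw)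
  · have happ := (isBoundedBilinearMap_apply (𝕜 := ℝ) (E := E) (F := G)).continuous.tendsto (A₀, u)
    exact tendsto_nhds_unique (happ.comp ((hA.comp hφt).prodMk_nhds hlim)) (hv.comp hφt)

/-- Limiting normals to a convex set are normals in the sense of convex analysis. -/
theorem inner_le_zero_of_mem_limitingNormalCone {Q : Set E} (hQ : Convex ℝ Q) {a v c : E}
    (hv : v ∈ limitingNormalCone Q a) (hc : c ∈ Q) : inner ℝ v (c - a) ≤ 0 := by
  obtain ⟨ζ, w, hζ, hw, h⟩ := hv
  refine le_of_tendsto (hw.inner (tendsto_const_nhds.sub hζ)) (Eventually.of_forall fun k => ?_)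
  refine (h k).2 _ ⟨fun j => 1 / ((j : ℝ) + 1), fun _ => c - ζ k, fun j => by positivity,
    tendsto_one_div_add_atTop_nhds_zero_nat, tendsto_const_nhds, fun j => ?_⟩
  refine hQ.add_smul_sub_mem (h k).1 hc ⟨by positivity, ?_⟩
  rw [div_le_one (by positivity)]
  have : (0 : ℝ) ≤ j := j.cast_nonneg
  linarith

/-- The residual of a nearest point is a regular normal. -/
theorem sub_mem_regularNormalCone_of_nearest {S : Set E} {x u : E}
    (h : ∀ s ∈ S, ‖x - u‖ ≤ ‖x - s‖) : x - u ∈ regularNormalCone S u := by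
  have hd : HasFDerivAt (fun s => (1 / 2 : ℝ) * ‖x - s‖ ^ 2) (-innerSL ℝ (x - u)) u := by
    have h1 : HasFDerivAt (fun s : E => x - s) (-ContinuousLinearMap.id ℝ E) u :=
      (hasFDerivAt_id u).const_sub x
    refine (h1.norm_sq.const_mul (1 / 2 : ℝ)).congr_fderiv ?_
    ext z
    simp
  refine mem_regularNormalCone_of_min hd ?_
  filter_upwards [self_mem_nhdsWithin] with s hs
  have := h s hs
  gcongr

end Normals

/-! ### Multipliers from subregularity, by penalization. -/

section Multipliers

variable {E G : Type*} [NormedAddCommGroup E] [InnerProductSpace ℝ E] [FiniteDimensional ℝ E]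
  [NormedAddCommGroup G] [InnerProductSpace ℝ G] [FiniteDimensional ℝ G]

/-- Exact penalization of a regular normal by the distance function. -/
theorem eventually_inner_le_infDist {S : Set E} {x v : E} (hx : x ∈ S)
    (hv : v ∈ regularNormalCone S x) {η : ℝ} (hη : 0 < η) :
    ∀ᶠ y in 𝓝 x, inner ℝ v (y - x) ≤ (‖v‖ + η) * Metric.infDist y S + η * ‖y - x‖ := by
  have h := eventually_inner_le_of_mem_regularNormalCone hv hη
  rw [eventually_nhdsWithin_iff, Metric.eventually_nhds_iff] at h
  obtain ⟨r, hr, h⟩ := h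
  filter_upwards [Metric.ball_mem_nhds x (half_pos hr)] with y hy
  rw [Metric.mem_ball] at hy
  have hlt : Metric.infDist y S < r / 2 := (Metric.infDist_le_dist_of_mem hx).trans_lt hy
  -- `S` need not be closed, so the distance may not be attained: argue with `d` slightly larger and
  -- let `d` decrease to it.
  have hev : ∀ᶠ d in 𝓝[>] (Metric.infDist y S),
      inner ℝ v (y - x) ≤ (‖v‖ + η) * d + η * ‖y - x‖ := by
    filter_upwards [self_mem_nhdsWithin, mem_nhdsWithin_of_mem_nhds (Iio_mem_nhds hlt)]
      with d hd1 hd2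
    obtain ⟨s, hs, hsd⟩ := (Metric.infDist_lt_iff ⟨x, hx⟩).1 hd1
    have hd2' : d < r / 2 := hd2
    have hsx : dist s x < r := by
      have := dist_triangle s y x
      rw [dist_comm s y] at this
      linarith
    have h1 := h hsx hs
    have h2 : inner ℝ v (y - x) = inner ℝ v (y - s) + inner ℝ v (s - x) := by
      rw [← inner_add_right, sub_add_sub_cancel]
    have h3 := real_inner_le_norm v (y - s)
    have h4 : ‖s - x‖ ≤ ‖y - s‖ + ‖y - x‖ := by
      have := norm_sub_le (y - x) (y - s)
      rw [sub_sub_sub_cancel_left] at this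
      linarith
    rw [dist_eq_norm] at hsd
    have h5 : ‖v‖ * ‖y - s‖ ≤ ‖v‖ * d := by gcongr
    have h6 : η * ‖s - x‖ ≤ η * (d + ‖y - x‖) := by gcongr; linarith
    linarith
  have hcont : Continuous fun d : ℝ => (‖v‖ + η) * d + η * ‖y - x‖ := by fun_prop
  exact ge_of_tendsto ((hcont.tendsto _).mono_left nhdsWithin_le_nhds) hev

/-- Smoothed norm: its derivative along a differentiable mapping. -/
theorem hasFDerivAt_sqrt_norm_sq_add {h : E → G} {h' : E →L[ℝ] G} {a : E} {δ : ℝ} (hδ : 0 < δ)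
    (hh : HasFDerivAt h h' a) :
    HasFDerivAt (fun x => √(‖h x‖ ^ 2 + δ ^ 2))
      (innerSL ℝ (ContinuousLinearMap.adjoint h' ((√(‖h a‖ ^ 2 + δ ^ 2))⁻¹ • h a))) a := by
  have hpos : 0 < ‖h a‖ ^ 2 + δ ^ 2 := by positivity
  refine ((hh.norm_sq.add_const (δ ^ 2)).sqrt hpos.ne').congr_fderiv ?_
  ext z
  have := (Real.sqrt_pos.2 hpos).ne'
  simp [ContinuousLinearMap.adjoint_inner_left]
  field_simp

omit [FiniteDimensional ℝ G] in
theorem norm_inv_sqrt_smul_le (z : G) (δ : ℝ) : ‖(√(‖z‖ ^ 2 + δ ^ 2))⁻¹ • z‖ ≤ 1 := by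
  rw [norm_smul, norm_inv, Real.norm_of_nonneg (Real.sqrt_nonneg _), inv_mul_eq_div]
  refine div_le_one_of_le₀ (Real.le_sqrt_of_sq_le ?_) (Real.sqrt_nonneg _)
  nlinarith [sq_nonneg δ]

/-- Regular normals to a metrically subregular constraint set admit approximate multipliers with
almost the modulus of subregularity as a bound. -/
theorem exists_approx_multiplier {S U : Set E} {D : Set G} {g : E → G} {κ : ℝ} (hκ : 0 ≤ κ)
    (hU : IsOpen U) (hg : ContDiffOn ℝ 1 g U)
    (hmod : ∀ x ∈ U, ∀ y ∈ D, Metric.infDist x S ≤ κ * ‖g x - y‖)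
    {x v : E} (hxS : x ∈ S) (hxU : x ∈ U) (hgx : g x ∈ D)
    (hD : ∃ r > 0, IsCompact (D ∩ Metric.closedBall (g x) r))
    (hv : v ∈ regularNormalCone S x) {ε : ℝ} (hε : 0 < ε) :
    ∃ x' y w, ‖x' - x‖ < ε ∧ ‖y - g x‖ < ε ∧ y ∈ D ∧ w ∈ regularNormalCone D y ∧
      ‖w‖ ≤ κ * ‖v‖ + ε ∧ ‖ContinuousLinearMap.adjoint (fderiv ℝ g x') w - v‖ ≤ ε := by
  obtain ⟨rD, hrD, hDc⟩ := hD
  set M := ‖fderiv ℝ g x‖ + 1 with hM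
  have hM0 : 0 < M := by positivity
  -- The multiplier bound loses `κη + 2η` and the adjoint equation `3η + 2Mη`; the denominator
  -- covers both.
  set η := ε / (κ + 5 + 2 * M) with hη_def
  have hden : 0 < κ + 5 + 2 * M := by positivity
  have hη : 0 < η := by positivity
  have hηε : η * (κ + 5 + 2 * M) = ε := div_mul_cancel₀ _ hden.ne'
  set K := (‖v‖ + η) * κ with hK
  have hK0 : 0 ≤ K := by positivity
  have hfd : ContinuousAt (fderiv ℝ g) x :=
    (hg.continuousOn_fderiv_of_isOpen hU le_rfl).continuousAt (hU.mem_nhds hxU)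
  have hev : ∀ᶠ y in 𝓝 x, y ∈ U ∧ ‖fderiv ℝ g y‖ < M ∧
      inner ℝ v (y - x) ≤ (‖v‖ + η) * Metric.infDist y S + η * ‖y - x‖ :=
    (hU.eventually_mem hxU).and ((hfd.norm.eventually (gt_mem_nhds (lt_add_one _))).and
      (eventually_inner_le_infDist hxS hv hη))
  obtain ⟨r, hr, hball⟩ := Metric.nhds_basis_closedBall.eventually_iff.1 hev
  set m := min η (min r rD) with hm
  have hm0 : 0 < m := lt_min hη (lt_min hr hrD)
  -- The penalty equals `K * δ` at `(x, g x)`; keeping this below `m ^ 2` forces minimizers to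
  -- within `m` of that point, so inside the balls.
  set δ := m ^ 2 / (K + 1) with hδ_def
  have hδ : 0 < δ := by positivity
  have hKδ : K * δ < m ^ 2 := by
    have : δ * (K + 1) = m ^ 2 := div_mul_cancel₀ _ (by positivity)
    nlinarith
  -- The norm is smoothed by `δ` to be differentiable where `g p.1 = p.2`; the two squares localize
  -- the minimizer.
  set Φ : E × G → ℝ := fun p => -inner ℝ v (p.1 - x) + η * ‖p.1 - x‖ +
    K * √(‖g p.1 - p.2‖ ^ 2 + δ ^ 2) + ‖p.1 - x‖ ^ 2 + ‖p.2 - g x‖ ^ 2 with hΦ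
  have hcomp : IsCompact (Metric.closedBall x r ×ˢ (D ∩ Metric.closedBall (g x) rD)) :=
    (isCompact_closedBall x r).prod hDc
  have hgc : ContinuousOn (fun p : E × G => g p.1)
      (Metric.closedBall x r ×ˢ (D ∩ Metric.closedBall (g x) rD)) :=
    hg.continuousOn.comp continuousOn_fst fun p hp => (hball hp.1).1
  have hΦc : ContinuousOn Φ (Metric.closedBall x r ×ˢ (D ∩ Metric.closedBall (g x) rD)) := by
    have h1 := (((hgc.sub continuousOn_snd).norm.pow 2).add
      (continuousOn_const (c := δ ^ 2))).sqrt
    have h2 : Continuous fun p : E × G => -inner ℝ v (p.1 - x) + η * ‖p.1 - x‖ := by fun_prop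
    have h3 : Continuous fun p : E × G => ‖p.1 - x‖ ^ 2 := by fun_prop
    have h4 : Continuous fun p : E × G => ‖p.2 - g x‖ ^ 2 := by fun_prop
    exact ((h2.continuousOn.add (continuousOn_const.mul h1)).add h3.continuousOn).add
      h4.continuousOn
  have hx0 : (x, g x) ∈ Metric.closedBall x r ×ˢ (D ∩ Metric.closedBall (g x) rD) :=
    ⟨Metric.mem_closedBall_self hr.le, hgx, Metric.mem_closedBall_self hrD.le⟩
  obtain ⟨⟨a, b⟩, ⟨ha, hbD, hb⟩, hmin⟩ := hcomp.exists_isMinOn ⟨_, hx0⟩ hΦc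
  have hmin' : ∀ x' ∈ Metric.closedBall x r, ∀ y ∈ D, y ∈ Metric.closedBall (g x) rD →
      Φ (a, b) ≤ Φ (x', y) := fun x' h1 y h2 h3 => hmin ⟨h1, h2, h3⟩
  have haU : a ∈ U := (hball ha).1
  have hΦ0 : Φ (x, g x) = K * δ := by
    simp [hΦ, Real.sqrt_sq hδ.le]
  -- Exact penalization and `hmod` make the remaining terms of `Φ` sum to a nonnegative number.
  have hlow : ‖a - x‖ ^ 2 + ‖b - g x‖ ^ 2 ≤ Φ (a, b) := by
    have h1 := (hball ha).2.2
    have h2 := hmod a haU b hbD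
    have h3 : (‖v‖ + η) * Metric.infDist a S ≤ (‖v‖ + η) * (κ * ‖g a - b‖) := by gcongr
    have h4 : ‖g a - b‖ ≤ √(‖g a - b‖ ^ 2 + δ ^ 2) :=
      Real.le_sqrt_of_sq_le (by nlinarith [sq_nonneg δ])
    have h5 : K * ‖g a - b‖ ≤ K * √(‖g a - b‖ ^ 2 + δ ^ 2) := by gcongr
    have h6 : (‖v‖ + η) * (κ * ‖g a - b‖) = K * ‖g a - b‖ := by rw [hK]; ring
    simp only [hΦ]
    linarith
  have hsmall : ‖a - x‖ ^ 2 + ‖b - g x‖ ^ 2 < m ^ 2 :=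
    (hlow.trans ((hmin' _ hx0.1 _ hx0.2.1 hx0.2.2).trans hΦ0.le)).trans_lt hKδ
  have ham : ‖a - x‖ < m := lt_of_pow_lt_pow_left₀ 2 hm0.le (by nlinarith [sq_nonneg ‖b - g x‖])
  have hbm : ‖b - g x‖ < m := lt_of_pow_lt_pow_left₀ 2 hm0.le (by nlinarith [sq_nonneg ‖a - x‖])
  have hmη : m ≤ η := min_le_left _ _
  have hmr : m ≤ r := (min_le_right _ _).trans (min_le_left _ _)
  have hmrD : m ≤ rD := (min_le_right _ _).trans (min_le_right _ _)
  set ρ := √(‖g a - b‖ ^ 2 + δ ^ 2) with hρ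
  set w₀ : G := ρ⁻¹ • (g a - b) with hw₀
  have hw₀n : ‖w₀‖ ≤ 1 := norm_inv_sqrt_smul_le _ _
  set A := ContinuousLinearMap.adjoint (fderiv ℝ g a) with hA
  have hga : HasFDerivAt g (fderiv ℝ g a) a :=
    ((hg.contDiffAt (hU.mem_nhds haU)).differentiableAt one_ne_zero).hasFDerivAt
  -- optimality in the first variable
  have hopt₁ : ‖-v + K • A w₀ + (2 : ℝ) • (a - x)‖ ≤ η := by
    have hd : HasFDerivAt (fun x' => -inner ℝ v (x' - x) + K * √(‖g x' - b‖ ^ 2 + δ ^ 2) +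
        ‖x' - x‖ ^ 2) (innerSL ℝ (-v + K • A w₀ + (2 : ℝ) • (a - x))) a := by
      have hid : HasFDerivAt (fun x' : E => x' - x) (ContinuousLinearMap.id ℝ E) a :=
        (hasFDerivAt_id a).sub_const x
      have h1 : HasFDerivAt (fun x' : E => inner ℝ v (x' - x)) (innerSL ℝ v) a :=
        ((innerSL ℝ v).hasFDerivAt.comp a hid).congr_fderiv (by ext; simp)
      refine ((h1.neg.add ((hasFDerivAt_sqrt_norm_sq_add hδ (hga.sub_const b)).const_mul K)).add
        hid.norm_sq).congr_fderiv ?_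
      ext z
      simp [hA, hw₀, hρ]
    rw [← innerSL_apply_norm (𝕜 := ℝ)]
    refine norm_fderiv_le_of_approx_min hη.le hd ?_
    have : Metric.ball x r ∈ 𝓝 a :=
      Metric.isOpen_ball.mem_nhds (by rw [mem_ball_iff_norm]; exact ham.trans_le hmr)
    filter_upwards [this] with x' hx'
    have h1 := hmin' x' (Metric.ball_subset_closedBall hx') b hbD hb
    simp only [hΦ] at h1
    have h2 : ‖x' - x‖ ≤ ‖x' - a‖ + ‖a - x‖ := norm_sub_le_norm_sub_add_norm_sub _ _ _
    have h3 := mul_le_mul_of_nonneg_left h2 hη.le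
    linarith
  -- optimality in the second variable
  have hopt₂ : K • w₀ - (2 : ℝ) • (b - g x) ∈ regularNormalCone D b := by
    have hd : HasFDerivAt (fun y => K * √(‖g a - y‖ ^ 2 + δ ^ 2) + ‖y - g x‖ ^ 2)
        (-innerSL ℝ (K • w₀ - (2 : ℝ) • (b - g x))) b := by
      have hid : HasFDerivAt (fun y : G => y - g x) (ContinuousLinearMap.id ℝ G) b :=
        (hasFDerivAt_id b).sub_const _
      have hid' : HasFDerivAt (fun y : G => g a - y) (-ContinuousLinearMap.id ℝ G) b :=
        (hasFDerivAt_id b).const_sub _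
      refine (((hasFDerivAt_sqrt_norm_sq_add hδ hid').const_mul K).add
        hid.norm_sq).congr_fderiv ?_
      ext z
      simp [ContinuousLinearMap.adjoint_inner_left, hw₀, hρ]
      ring
    refine mem_regularNormalCone_of_min hd ?_
    have : Metric.ball (g x) rD ∈ 𝓝 b :=
      Metric.isOpen_ball.mem_nhds (by rw [mem_ball_iff_norm]; exact hbm.trans_le hmrD)
    filter_upwards [self_mem_nhdsWithin, mem_nhdsWithin_of_mem_nhds this] with y hyD hy
    have h1 := hmin' a ha y hyD (Metric.ball_subset_closedBall hy)
    simp only [hΦ] at h1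
    linarith
  have hsum : η * κ + 5 * η + 2 * (η * M) = ε := by rw [← hηε]; ring
  have hκη : 0 ≤ η * κ := by positivity
  have hMη : 0 ≤ η * M := by positivity
  have hKη : K = κ * ‖v‖ + η * κ := by rw [hK]; ring
  have hKw : ‖K • w₀‖ ≤ K := by
    rw [norm_smul, Real.norm_of_nonneg hK0]
    exact mul_le_of_le_one_right hK0 hw₀n
  have h2b : ‖(2 : ℝ) • (b - g x)‖ ≤ 2 * η := by
    rw [norm_smul, Real.norm_ofNat]
    linarith
  have h2a : ‖(2 : ℝ) • (a - x)‖ ≤ 2 * η := by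
    rw [norm_smul, Real.norm_ofNat]
    linarith
  refine ⟨a, b, _, by linarith, by linarith, hbD, hopt₂, ?_, ?_⟩
  · have := norm_sub_le (K • w₀) ((2 : ℝ) • (b - g x))
    linarith
  · have hAM : ‖A‖ ≤ M := by
      rw [hA, LinearIsometryEquiv.norm_map]
      exact (hball ha).2.1.le
    have hAb : ‖A ((2 : ℝ) • (b - g x))‖ ≤ M * (2 * η) :=
      (A.le_opNorm _).trans (mul_le_mul hAM h2b (norm_nonneg _) hM0.le)
    have heq : A (K • w₀ - (2 : ℝ) • (b - g x)) - v =
        (-v + K • A w₀ + (2 : ℝ) • (a - x)) - (2 : ℝ) • (a - x) - A ((2 : ℝ) • (b - g x)) := by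
      rw [map_sub, map_smul A K]
      abel
    rw [heq]
    have h1 := norm_sub_le ((-v + K • A w₀ + (2 : ℝ) • (a - x)) - (2 : ℝ) • (a - x))
      (A ((2 : ℝ) • (b - g x)))
    have h2 := norm_sub_le (-v + K • A w₀ + (2 : ℝ) • (a - x)) ((2 : ℝ) • (a - x))
    linarith

/-- Limiting normals to a metrically subregular constraint set admit multipliers bounded by the
modulus of subregularity. -/
theorem exists_multiplier {S U : Set E} {D : Set G} {g : E → G} {κ : ℝ} (hκ : 0 ≤ κ)
    (hU : IsOpen U) (hg : ContDiffOn ℝ 1 g U)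
    (hmod : ∀ x ∈ U, ∀ y ∈ D, Metric.infDist x S ≤ κ * ‖g x - y‖)
    (hSD : ∀ x ∈ S, x ∈ U → g x ∈ D)
    (hD : ∀ x ∈ U, ∃ r > 0, IsCompact (D ∩ Metric.closedBall (g x) r))
    {x v : E} (hxU : x ∈ U) (hv : v ∈ limitingNormalCone S x) :
    ∃ w ∈ limitingNormalCone D (g x), ‖w‖ ≤ κ * ‖v‖ ∧
      ContinuousLinearMap.adjoint (fderiv ℝ g x) w = v := by
  obtain ⟨ζ, ν, hζ, hν, hζν⟩ := hv
  have hfd : ContinuousAt (fderiv ℝ g) x :=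
    (hg.continuousOn_fderiv_of_isOpen hU le_rfl).continuousAt (hU.mem_nhds hxU)
  have hgx : ContinuousAt g x := hg.continuousOn.continuousAt (hU.mem_nhds hxU)
  set e : ℕ → ℝ := fun k => 1 / ((k : ℝ) + 1) with he
  have he0 : Tendsto e atTop (𝓝 0) := tendsto_one_div_add_atTop_nhds_zero_nat
  have key : ∀ k, ∃ x' y w, ζ k ∈ U → ‖x' - ζ k‖ < e k ∧ ‖y - g (ζ k)‖ < e k ∧ y ∈ D ∧
      w ∈ regularNormalCone D y ∧ ‖w‖ ≤ κ * ‖ν k‖ + e k ∧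
      ‖ContinuousLinearMap.adjoint (fderiv ℝ g x') w - ν k‖ ≤ e k := by
    intro k
    by_cases hk : ζ k ∈ U
    · obtain ⟨x', y, w, h⟩ := exists_approx_multiplier hκ hU hg hmod (hζν k).1 hk
        (hSD _ (hζν k).1 hk) (hD _ hk) (hζν k).2 (ε := e k) (by positivity)
      exact ⟨x', y, w, fun _ => h⟩
    -- Dummy values; `ζ k` lies in `U` for all large `k`.
    · exact ⟨0, 0, 0, fun h => absurd h hk⟩
  choose ξ y w h using key
  have hζU : ∀ᶠ k in atTop, ζ k ∈ U := hζ.eventually (hU.mem_nhds hxU)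
  have hξ : Tendsto ξ atTop (𝓝 x) := by
    have : Tendsto (fun k => ξ k - ζ k) atTop (𝓝 0) :=
      squeeze_zero_norm' (hζU.mono fun k hk => (h k hk).1.le) he0
    simpa using this.add hζ
  have hy : Tendsto y atTop (𝓝 (g x)) := by
    have : Tendsto (fun k => y k - g (ζ k)) atTop (𝓝 0) :=
      squeeze_zero_norm' (hζU.mono fun k hk => (h k hk).2.1.le) he0
    simpa using this.add (hgx.tendsto.comp hζ)
  have hAw : Tendsto (fun k => ContinuousLinearMap.adjoint (fderiv ℝ g (ξ k)) (w k)) atTop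
      (𝓝 v) := by
    have : Tendsto (fun k => ContinuousLinearMap.adjoint (fderiv ℝ g (ξ k)) (w k) - ν k) atTop
        (𝓝 0) := squeeze_zero_norm' (hζU.mono fun k hk => (h k hk).2.2.2.2.2) he0
    simpa using this.add hν
  refine exists_multiplier_of_tendsto hy
    ((ContinuousLinearMap.adjoint.continuous.tendsto _).comp (hfd.tendsto.comp hξ)) hAw
    (ρ := fun k => κ * ‖ν k‖ + e k) (by simpa using (hν.norm.const_mul κ).add he0)
    (hζU.mono fun k hk => (h k hk).2.2.2.2.1)
    (hζU.mono fun k hk => regularNormalCone_subset_limitingNormalCone (h k hk).2.2.1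
      (h k hk).2.2.2.1)

end Multipliers

/-! ### Super-regularity of `C` and moduli of subregularity. -/

section Subregularity

theorem infDist_le_of_infEDist_le {X Y : Type*} [PseudoMetricSpace X] [NormedAddCommGroup Y]
    {S : Set X} {B : Set Y} {x : X} {y : Y} {κ : ℝ≥0}
    (h : Metric.infEDist x S ≤ (κ : ℝ≥0∞) * Metric.infEDist 0 B) (hy : y ∈ B) :
    Metric.infDist x S ≤ κ * ‖y‖ := by
  have h1 : Metric.infEDist x S ≤ (κ : ℝ≥0∞) * ‖y‖ₑ := by
    refine h.trans ?_
    gcongr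
    simpa [edist_zero_left, enorm_eq_nnnorm] using Metric.infEDist_le_edist_of_mem (x := 0) hy
  have h2 := ENNReal.toReal_mono (ENNReal.mul_ne_top ENNReal.coe_ne_top enorm_ne_top) h1
  simpa [Metric.infDist] using h2

theorem zero_mem_constraintMap_iff {X Y : Type*} [AddCommGroup Y] {f : X → Y} {C : Set Y} {x : X} :
    0 ∈ constraintMap f C x ↔ f x ∈ C := by
  constructor
  · rintro ⟨c, hc, h⟩
    rwa [sub_eq_zero.1 h.symm]
  · exact fun h => ⟨f x, h, (sub_self _).symm⟩

theorem setOf_zero_mem_constraintMap {X Y : Type*} [AddCommGroup Y] (f : X → Y) (C : Set Y) :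
    {x | 0 ∈ constraintMap f C x} = f ⁻¹' C :=
  Set.ext fun _ => zero_mem_constraintMap_iff

/-- A `C¹` mapping is uniformly approximated by its linearizations near a point. -/
theorem exists_norm_sub_sub_fderiv_le {E G : Type*} [NormedAddCommGroup E] [NormedSpace ℝ E]
    [NormedAddCommGroup G] [NormedSpace ℝ G] {g : E → G} {U : Set E} (hU : IsOpen U)
    (hg : ContDiffOn ℝ 1 g U) {a : E} (ha : a ∈ U) {η : ℝ} (hη : 0 < η) :
    ∃ r > 0, ∀ x ∈ Metric.ball a r, ∀ y ∈ Metric.ball a r,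
      ‖g y - g x - fderiv ℝ g x (y - x)‖ ≤ η * ‖y - x‖ := by
  have hs := (hg.contDiffAt (hU.mem_nhds ha)).hasStrictFDerivAt one_ne_zero
  have hfd : ContinuousAt (fderiv ℝ g) a :=
    (hg.continuousOn_fderiv_of_isOpen hU le_rfl).continuousAt (hU.mem_nhds ha)
  have h1 := hs.isLittleO.bound (half_pos hη)
  have h2 : ∀ᶠ x in 𝓝 a, ‖fderiv ℝ g x - fderiv ℝ g a‖ < η / 2 := by
    have := hfd.eventually (Metric.ball_mem_nhds _ (half_pos hη))
    simpa only [mem_ball_iff_norm, Metric.mem_ball, dist_eq_norm] using this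
  rw [nhds_prod_eq] at h1
  obtain ⟨r₁, hr₁, h1⟩ := (Metric.nhds_basis_ball.prod_self).eventually_iff.1 h1
  obtain ⟨r₂, hr₂, h2⟩ := Metric.nhds_basis_ball.eventually_iff.1 h2
  refine ⟨min r₁ r₂, lt_min hr₁ hr₂, fun x hx y hy => ?_⟩
  have hy1 := Metric.ball_subset_ball (min_le_left r₁ r₂) hy
  have hx1 := Metric.ball_subset_ball (min_le_left r₁ r₂) hx
  have hx2 := h2 (Metric.ball_subset_ball (min_le_right r₁ r₂) hx)
  have e1 : ‖g y - g x - fderiv ℝ g a (y - x)‖ ≤ η / 2 * ‖y - x‖ := h1 (x := (y, x)) ⟨hy1, hx1⟩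
  have e2 : ‖(fderiv ℝ g x - fderiv ℝ g a) (y - x)‖ ≤ η / 2 * ‖y - x‖ :=
    (ContinuousLinearMap.le_opNorm _ _).trans (by gcongr)
  have e3 : g y - g x - fderiv ℝ g x (y - x) = (g y - g x - fderiv ℝ g a (y - x)) -
      (fderiv ℝ g x - fderiv ℝ g a) (y - x) := by
    rw [sub_apply]
    abel
  rw [e3]
  linarith [norm_sub_le (g y - g x - fderiv ℝ g a (y - x))
    ((fderiv ℝ g x - fderiv ℝ g a) (y - x))]

variable {n l : ℕ}

/-- Subamenable sets are locally closed. -/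
theorem SubamenableAt.exists_isCompact {C : Set (EuclideanSpace ℝ (Fin l))}
    {z₀ : EuclideanSpace ℝ (Fin l)} (hC : SubamenableAt C z₀) :
    ∃ W, IsOpen W ∧ z₀ ∈ W ∧ ∀ z ∈ W, ∃ r > 0, IsCompact (C ∩ Metric.closedBall z r) := by
  obtain ⟨-, W, d, q, Q, hW, hz₀, hq, hQ, -, hCW, -⟩ := hC
  refine ⟨W, hW, hz₀, fun z hz => ?_⟩
  obtain ⟨r, hr, hrW⟩ := Metric.nhds_basis_closedBall.mem_iff.1 (hW.mem_nhds hz)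
  refine ⟨r, hr, (isCompact_closedBall z r).of_isClosed_subset ?_ inter_subset_right⟩
  have heq : C ∩ Metric.closedBall z r = Metric.closedBall z r ∩ q ⁻¹' Q := by
    ext y
    constructor
    · rintro ⟨h1, h2⟩
      exact ⟨h2, (hCW.subset ⟨h1, hrW h2⟩).2⟩
    · rintro ⟨h1, h2⟩
      exact ⟨(hCW.superset ⟨hrW h1, h2⟩).1, h1⟩
  rw [heq]
  exact (hq.continuousOn.mono hrW).preimage_isClosed_of_isClosed Metric.isClosed_closedBall hQ

/-- Subamenable sets are super-regular: limiting normals satisfy the inequality of convex analysis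
up to an arbitrarily small relative error, uniformly near the reference point. -/
theorem SubamenableAt.exists_inner_le {C : Set (EuclideanSpace ℝ (Fin l))}
    {z₀ : EuclideanSpace ℝ (Fin l)} (hC : SubamenableAt C z₀) {ε : ℝ} (hε : 0 < ε) :
    ∃ r > 0, ∀ z ∈ C ∩ Metric.ball z₀ r, ∀ c ∈ C ∩ Metric.ball z₀ r,
      ∀ w ∈ limitingNormalCone C z, inner ℝ w (c - z) ≤ ε * ‖w‖ * ‖c - z‖ := by
  obtain ⟨-, W, d, q, Q, hW, hz₀, hq, hQ, hQc, hCW, -, κ, U₀, hU₀, hκ⟩ := hC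
  obtain ⟨U, hUsub, hU, hz₀U⟩ := mem_nhds_iff.1 (inter_mem hU₀ (hW.mem_nhds hz₀))
  have hset : {z | (0 : EuclideanSpace ℝ (Fin d)) ∈ {y | z ∈ W ∧ y ∈ constraintMap q Q z}}
      = C ∩ W := by
    rw [hCW]
    ext z
    exact and_congr_right fun _ => zero_mem_constraintMap_iff
  have hqU : ContDiffOn ℝ 1 q U := hq.mono fun z hz => (hUsub hz).2
  have hmod : ∀ z ∈ U, ∀ y ∈ Q, Metric.infDist z C ≤ κ * ‖q z - y‖ := by
    intro z hz y hy
    have h := hκ z (hUsub hz).1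
    rw [hset] at h
    refine infDist_le_of_infEDist_le ((Metric.infEDist_anti inter_subset_left).trans h) ?_
    exact ⟨(hUsub hz).2, y, hy, rfl⟩
  -- The multiplier `μ` has norm at most `κ * ‖w‖`, so this linearization accuracy yields a final
  -- error below `ε`; the `+ 1` covers `κ = 0`.
  have hη : 0 < ε / (κ + 1) := by positivity
  obtain ⟨r₁, hr₁, hlin⟩ := exists_norm_sub_sub_fderiv_le hU hqU hz₀U hη
  obtain ⟨r₂, hr₂, hr₂U⟩ := Metric.isOpen_iff.1 hU z₀ hz₀U
  refine ⟨min r₁ r₂, lt_min hr₁ hr₂, ?_⟩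
  rintro z ⟨hzC, hz⟩ c ⟨hcC, hc⟩ w hw
  have hzU : z ∈ U := hr₂U (Metric.ball_subset_ball (min_le_right _ _) hz)
  have hcU : c ∈ U := hr₂U (Metric.ball_subset_ball (min_le_right _ _) hc)
  have hCQ : ∀ y ∈ C, y ∈ U → q y ∈ Q := fun y h1 h2 => (hCW.subset ⟨h1, (hUsub h2).2⟩).2
  obtain ⟨μ, hμ, hμn, rfl⟩ := exists_multiplier κ.coe_nonneg hU hqU hmod hCQ
    (fun y _ => ⟨1, one_pos, (isCompact_closedBall _ _).inter_left hQ⟩) hzU hw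
  set w := ContinuousLinearMap.adjoint (fderiv ℝ q z) μ
  have h1 := inner_le_zero_of_mem_limitingNormalCone hQc hμ (hCQ c hcC hcU)
  have h2 := hlin z (Metric.ball_subset_ball (min_le_left _ _) hz) c
    (Metric.ball_subset_ball (min_le_left _ _) hc)
  have h3 : inner ℝ w (c - z) = inner ℝ μ (q c - q z) -
      inner ℝ μ (q c - q z - fderiv ℝ q z (c - z)) := by
    rw [ContinuousLinearMap.adjoint_inner_left, ← inner_sub_right, sub_sub_cancel]
  have h4 := (abs_le.1 (abs_real_inner_le_norm μ (q c - q z - fderiv ℝ q z (c - z)))).1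
  have h5 : ‖μ‖ * ‖q c - q z - fderiv ℝ q z (c - z)‖ ≤
      (κ * ‖w‖) * (ε / (κ + 1) * ‖c - z‖) := by gcongr
  have h6 : (κ * ‖w‖) * (ε / (κ + 1) * ‖c - z‖) = (κ / (κ + 1)) * (ε * ‖w‖ * ‖c - z‖) := by
    ring
  have h7 : ((κ : ℝ) / (κ + 1)) * (ε * ‖w‖ * ‖c - z‖) ≤ ε * ‖w‖ * ‖c - z‖ :=
    mul_le_of_le_one_left (by positivity)
      (div_le_one_of_le₀ (by linarith) (by positivity))
  linarith

/-- A modulus of subregularity bounds multipliers of limiting normals near the reference point. -/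
theorem eventually_exists_multiplier
    {f : EuclideanSpace ℝ (Fin n) → EuclideanSpace ℝ (Fin l)} (hf : ContDiff ℝ 1 f)
    {C : Set (EuclideanSpace ℝ (Fin l))} {x₀ : EuclideanSpace ℝ (Fin n)}
    (hC : SubamenableAt C (f x₀)) {κ : ℝ≥0}
    (hκ : IsSubregularityModulus (constraintMap f C) x₀ 0 κ) :
    ∀ᶠ x in 𝓝 x₀, ∀ v ∈ limitingNormalCone (f ⁻¹' C) x,
      ∃ w ∈ limitingNormalCone C (f x), ‖w‖ ≤ κ * ‖v‖ ∧ adjointDeriv f x w = v := by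
  obtain ⟨W, hW, hW₀, hcomp⟩ := hC.exists_isCompact
  obtain ⟨U₀, hU₀, hκ⟩ := hκ
  rw [setOf_zero_mem_constraintMap] at hκ
  obtain ⟨U, hUsub, hU, hx₀U⟩ := mem_nhds_iff.1
    (inter_mem hU₀ ((hW.preimage hf.continuous).mem_nhds hW₀))
  filter_upwards [hU.mem_nhds hx₀U] with x hx v hv
  exact exists_multiplier κ.coe_nonneg hU hf.contDiffOn
    (fun y hy c hc => infDist_le_of_infEDist_le (hκ y (hUsub hy).1) ⟨c, hc, rfl⟩)
    (fun y hy _ => hy) (fun y hy => hcomp _ (hUsub hy).2) hx hv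

/-- Points near a locally closed set have nearest points in it. -/
theorem exists_nearest_of_isClosed {E : Type*} [NormedAddCommGroup E] [ProperSpace E]
    {S : Set E} {x₀ x : E} {r : ℝ} (hS : IsClosed (S ∩ Metric.closedBall x₀ r)) (hx₀ : x₀ ∈ S)
    (hx : ‖x - x₀‖ < r / 2) :
    ∃ u ∈ S, ‖u - x₀‖ ≤ 2 * ‖x - x₀‖ ∧ ∀ s ∈ S, ‖x - u‖ ≤ ‖x - s‖ := by
  have hr : 0 < r := by linarith [norm_nonneg (x - x₀)]
  have hmem : x₀ ∈ S ∩ Metric.closedBall x₀ r := ⟨hx₀, Metric.mem_closedBall_self hr.le⟩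
  obtain ⟨u, ⟨huS, -⟩, hu⟩ := hS.exists_infDist_eq_dist ⟨x₀, hmem⟩ x
  have hnear : ∀ s ∈ S ∩ Metric.closedBall x₀ r, ‖x - u‖ ≤ ‖x - s‖ := fun s hs => by
    rw [← dist_eq_norm, ← dist_eq_norm, ← hu]
    exact Metric.infDist_le_dist_of_mem hs
  have h0 := hnear x₀ hmem
  refine ⟨u, huS, ?_, fun s hs => ?_⟩
  · have := norm_sub_le_norm_sub_add_norm_sub u x x₀
    rw [norm_sub_rev u x] at this
    linarith
  -- Points of `S` outside the ball are farther than `r / 2` from `x`, hence farther than `x₀` is.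
  · by_cases h : s ∈ Metric.closedBall x₀ r
    · exact hnear s ⟨hs, h⟩
    · rw [mem_closedBall_iff_norm, not_le] at h
      have := norm_sub_le_norm_sub_add_norm_sub s x x₀
      rw [norm_sub_rev s x] at this
      linarith

/-- Uniformly bounded multipliers yield a modulus of subregularity. -/
theorem isSubregularityModulus_of_multipliers
    {f : EuclideanSpace ℝ (Fin n) → EuclideanSpace ℝ (Fin l)} (hf : ContDiff ℝ 1 f)
    {C : Set (EuclideanSpace ℝ (Fin l))} {x₀ : EuclideanSpace ℝ (Fin n)}
    (hC : SubamenableAt C (f x₀)) {τ κ : ℝ≥0} (hτκ : τ < κ)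
    (hmul : ∀ᶠ x in 𝓝[f ⁻¹' C] x₀, ∀ v ∈ limitingNormalCone (f ⁻¹' C) x ∩ Metric.closedBall 0 1,
      ∃ w ∈ limitingNormalCone C (f x), ‖w‖ ≤ τ ∧ adjointDeriv f x w = v) :
    IsSubregularityModulus (constraintMap f C) x₀ 0 κ := by
  have hx₀ : x₀ ∈ f ⁻¹' C := hC.1
  obtain ⟨L, t, ht, hL⟩ := (hf.contDiffAt (x := x₀)).exists_lipschitzOnWith
  have hτ0 : (0 : ℝ) ≤ τ := τ.coe_nonneg
  have hτκ' : (τ : ℝ) < κ := hτκ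
  have hκ0 : (0 : ℝ) < κ := hτ0.trans_lt hτκ'
  -- With `ε * m = κ - τ` the final comparison `τ * (1 + ε) ≤ κ * σ` holds with slack exactly `ε`,
  -- which comes from the `+ 1`.
  set m : ℝ := τ + κ * (τ * (1 + L)) + 1 with hm
  have hm0 : 0 < m := by positivity
  obtain ⟨ε, hε, hεm⟩ : ∃ ε : ℝ, 0 < ε ∧ ε * m = κ - τ :=
    ⟨(κ - τ) / m, div_pos (sub_pos.2 hτκ') hm0, div_mul_cancel₀ _ hm0.ne'⟩
  obtain ⟨r₁, hr₁, hlin⟩ :=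
    exists_norm_sub_sub_fderiv_le isOpen_univ hf.contDiffOn (mem_univ x₀) hε
  obtain ⟨r₂, hr₂, hreg⟩ := hC.exists_inner_le hε
  obtain ⟨W, -, hW₀, hcomp⟩ := hC.exists_isCompact
  obtain ⟨r₃, hr₃, hcomp⟩ := hcomp _ hW₀
  rw [eventually_nhdsWithin_iff] at hmul
  have hev : ∀ᶠ x in 𝓝 x₀, x ∈ Metric.ball x₀ r₁ ∧ x ∈ t ∧ f x ∈ Metric.ball (f x₀) (r₂ / 2) ∧
      f x ∈ Metric.closedBall (f x₀) r₃ ∧ (x ∈ f ⁻¹' C →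
        ∀ v ∈ limitingNormalCone (f ⁻¹' C) x ∩ Metric.closedBall 0 1,
          ∃ w ∈ limitingNormalCone C (f x), ‖w‖ ≤ τ ∧ adjointDeriv f x w = v) :=
    (show ∀ᶠ x in 𝓝 x₀, x ∈ Metric.ball x₀ r₁ from Metric.ball_mem_nhds x₀ hr₁).and
    (Filter.Eventually.and ht
      ((hf.continuous.continuousAt.eventually (Metric.ball_mem_nhds _ (half_pos hr₂))).and
      ((hf.continuous.continuousAt.eventually (Metric.closedBall_mem_nhds _ hr₃)).and hmul)))
  obtain ⟨r, hr, hball⟩ := Metric.nhds_basis_closedBall.eventually_iff.1 hev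
  have hclosed : IsClosed (f ⁻¹' C ∩ Metric.closedBall x₀ r) := by
    have : f ⁻¹' C ∩ Metric.closedBall x₀ r =
        f ⁻¹' (C ∩ Metric.closedBall (f x₀) r₃) ∩ Metric.closedBall x₀ r := by
      ext y
      exact ⟨fun h => ⟨⟨h.1, (hball h.2).2.2.2.1⟩, h.2⟩, fun h => ⟨h.1.1, h.2⟩⟩
    rw [this]
    exact (hcomp.isClosed.preimage hf.continuous).inter Metric.isClosed_closedBall
  refine ⟨Metric.ball x₀ (r / 2), Metric.ball_mem_nhds _ (half_pos hr), fun x hx => ?_⟩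
  rw [setOf_zero_mem_constraintMap]
  rw [mem_ball_iff_norm] at hx
  obtain ⟨u, huS, hux₀, hu⟩ := exists_nearest_of_isClosed hclosed hx₀ hx
  have hxb := hball (mem_closedBall_iff_norm.2 (show ‖x - x₀‖ ≤ r by linarith))
  have hub := hball (mem_closedBall_iff_norm.2 (show ‖u - x₀‖ ≤ r by linarith))
  -- This restriction keeps `c` in the ball where super-regularity holds; for farther `c` the
  -- estimate at `f x₀` suffices.
  have hest : ∀ c ∈ C, ‖f x - c‖ ≤ ‖f x - f x₀‖ → ‖x - u‖ ≤ κ * ‖f x - c‖ := by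
    intro c hc hcx
    rcases eq_or_ne x u with rfl | hne
    · rw [sub_self, norm_zero]
      positivity
    have hpos : 0 < ‖x - u‖ := norm_pos_iff.2 (sub_ne_zero.2 hne)
    have hv : ‖x - u‖⁻¹ • (x - u) ∈ limitingNormalCone (f ⁻¹' C) u :=
      smul_mem_limitingNormalCone (regularNormalCone_subset_limitingNormalCone huS
        (sub_mem_regularNormalCone_of_nearest hu)) (by positivity)
    have hv1 : ‖x - u‖⁻¹ • (x - u) ∈ Metric.closedBall (0 : EuclideanSpace ℝ (Fin n)) 1 := by
      rw [mem_closedBall_zero_iff, norm_smul, norm_inv, norm_norm, inv_mul_cancel₀ hpos.ne']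
    obtain ⟨w, hw, hwn, hwv⟩ := hub.2.2.2.2 huS _ ⟨hv, hv1⟩
    have hcb : c ∈ Metric.ball (f x₀) r₂ := by
      have h1 := mem_ball_iff_norm.1 hxb.2.2.1
      have h2 := norm_sub_le_norm_sub_add_norm_sub c (f x) (f x₀)
      rw [norm_sub_rev c (f x)] at h2
      rw [mem_ball_iff_norm]
      linarith
    have hreg' := hreg (f u) ⟨huS, Metric.ball_subset_ball (by linarith) hub.2.2.1⟩ c ⟨hc, hcb⟩ w hw
    have hlip : ‖f x - f u‖ ≤ L * ‖x - u‖ := by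
      simpa [dist_eq_norm] using hL.dist_le_mul x hxb.2.1 u hub.2.1
    have hlin' := hlin u hub.1 x hxb.1
    have hcu : ‖c - f u‖ ≤ ‖f x - c‖ + L * ‖x - u‖ := by
      have := norm_sub_le_norm_sub_add_norm_sub c (f x) (f u)
      rw [norm_sub_rev c (f x)] at this
      linarith
    have hid : ‖x - u‖ = inner ℝ w (f x - c) + inner ℝ w (c - f u) -
        inner ℝ w (f x - f u - fderiv ℝ f u (x - u)) := by
      rw [← inner_add_right, sub_add_sub_cancel, ← inner_sub_right, sub_sub_cancel,
        ← ContinuousLinearMap.adjoint_inner_left]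
      change _ = inner ℝ (adjointDeriv f u w) (x - u)
      rw [hwv, real_inner_smul_left, real_inner_self_eq_norm_sq]
      field_simp
    have e1 : inner ℝ w (f x - c) ≤ τ * ‖f x - c‖ :=
      (real_inner_le_norm _ _).trans (by gcongr)
    have e2 : inner ℝ w (c - f u) ≤ ε * τ * (‖f x - c‖ + L * ‖x - u‖) :=
      hreg'.trans (by gcongr)
    have e3 : -inner ℝ w (f x - f u - fderiv ℝ f u (x - u)) ≤ τ * (ε * ‖x - u‖) :=
      ((neg_le_abs _).trans (abs_real_inner_le_norm _ _)).trans (by gcongr)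
    -- What remains of the coefficient of `‖x - u‖` after absorbing the super-regularity and
    -- linearization errors.
    set σ := 1 - ε * (τ * (1 + L)) with hσ
    have hσκ : τ * (1 + ε) ≤ κ * σ := by
      have : κ * σ - τ * (1 + ε) = κ - τ - ε * m + ε := by rw [hσ, hm]; ring
      linarith
    have hσ0 : 0 < σ := by
      have : ε * m = ε * τ + κ * (ε * (τ * (1 + L))) + ε := by rw [hm]; ring
      have h1 : 0 ≤ ε * τ := by positivity
      have h2 : κ * σ = κ - κ * (ε * (τ * (1 + L))) := by rw [hσ]; ring
      exact pos_of_mul_pos_right (a := (κ : ℝ)) (by linarith) hκ0.le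
    have hfin : σ * ‖x - u‖ ≤ σ * (κ * ‖f x - c‖) := by
      have h1 : σ * ‖x - u‖ ≤ τ * (1 + ε) * ‖f x - c‖ := by
        have : σ * ‖x - u‖ = ‖x - u‖ - ε * τ * (L * ‖x - u‖) - τ * (ε * ‖x - u‖) := by
          rw [hσ]; ring
        linarith
      have h2 : τ * (1 + ε) * ‖f x - c‖ ≤ κ * σ * ‖f x - c‖ := by gcongr
      linarith
    exact le_of_mul_le_mul_left hfin hσ0
  have hest' : ∀ c ∈ C, ‖x - u‖ ≤ κ * ‖f x - c‖ := by
    intro c hc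
    rcases le_total ‖f x - c‖ ‖f x - f x₀‖ with h | h
    · exact hest c hc h
    · exact (hest _ hC.1 le_rfl).trans (by gcongr)
  have hκtop : (κ : ℝ≥0∞) ≠ 0 := by
    simpa using hκ0.ne'
  refine (Metric.infEDist_le_edist_of_mem huS).trans ?_
  rw [mul_comm, ← ENNReal.div_le_iff hκtop ENNReal.coe_ne_top, Metric.le_infEDist]
  rintro y ⟨c, hc, rfl⟩
  rw [ENNReal.div_le_iff hκtop ENNReal.coe_ne_top, edist_zero_left, ← enorm_eq_nnnorm,
    edist_eq_enorm_sub]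
  have := hest' c hc
  rw [← ofReal_norm, ← ofReal_norm, ← ENNReal.ofReal_coe_nnreal,
    ← ENNReal.ofReal_mul (norm_nonneg _)]
  exact ENNReal.ofReal_le_ofReal (by linarith)

end Subregularity

/-! ### The upper limit formulas. -/

section Bounds

variable {n l : ℕ}

/-- The least uniform bound of multipliers of unit normals equals the least scaling factor in the
inclusion of unit normals. -/
theorem iSup_iInf_enorm_eq_iInf_subset {E G : Type*} [NormedAddCommGroup E]
    [InnerProductSpace ℝ E] [NormedAddCommGroup G] [InnerProductSpace ℝ G] (V : Set E) (N : Set G)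
    (hN : ∀ w ∈ N, ∀ t : ℝ, 0 ≤ t → t • w ∈ N) (A : G →L[ℝ] E) :
    ⨆ v ∈ V, ⨅ u ∈ {u | u ∈ N ∧ A u = v}, ‖u‖ₑ =
      ⨅ τ ∈ {τ : ℝ≥0 | V ⊆ (τ : ℝ) • (A '' (N ∩ Metric.closedBall 0 1))}, (τ : ℝ≥0∞) := by
  refine le_antisymm ?_ ?_
  · refine le_iInf₂ fun τ hτ => iSup₂_le fun v hv => ?_
    obtain ⟨-, ⟨w, ⟨hwN, hw⟩, rfl⟩, rfl⟩ := hτ hv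
    refine iInf₂_le_of_le ((τ : ℝ) • w) ⟨hN w hwN _ τ.coe_nonneg, map_smul A _ w⟩ ?_
    rw [enorm_le_coe, ← NNReal.coe_le_coe, coe_nnnorm, norm_smul, NNReal.norm_eq]
    exact mul_le_of_le_one_right τ.coe_nonneg (mem_closedBall_zero_iff.1 hw)
  · refine le_of_forall_gt_imp_ge_of_dense fun b hb => ?_
    obtain ⟨τ, hτ, hτb⟩ := ENNReal.lt_iff_exists_nnreal_btwn.1 hb
    refine (iInf₂_le τ fun v hv => ?_).trans hτb.le
    have hv' := (le_iSup₂ (f := fun v (_ : v ∈ V) => ⨅ u ∈ {u | u ∈ N ∧ A u = v}, ‖u‖ₑ) v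
      hv).trans_lt hτ
    obtain ⟨w, ⟨hwN, rfl⟩, hw⟩ := by simpa only [iInf_lt_iff, exists_prop] using hv'
    -- Being strictly above a supremum in `[0, ∞]`, `τ` is positive, so dividing by it moves `w`
    -- into the unit ball.
    have hτ0 : (0 : ℝ) < τ := by
      have := pos_of_gt hτ
      exact_mod_cast this
    rw [enorm_lt_coe, ← NNReal.coe_lt_coe, coe_nnnorm] at hw
    refine ⟨A ((τ : ℝ)⁻¹ • w), ⟨_, ⟨hN w hwN _ (by positivity), ?_⟩, rfl⟩, ?_⟩
    · rw [mem_closedBall_zero_iff, norm_smul, norm_inv, NNReal.norm_eq, inv_mul_eq_div]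
      exact div_le_one_of_le₀ hw.le hτ0.le
    · simp only [map_smul]
      rw [smul_smul, mul_inv_cancel₀ hτ0.ne', one_smul]

theorem iUnion_constraintCoderiv (f : EuclideanSpace ℝ (Fin n) → EuclideanSpace ℝ (Fin l))
    (C : Set (EuclideanSpace ℝ (Fin l))) (x : EuclideanSpace ℝ (Fin n))
    (B : Set (EuclideanSpace ℝ (Fin l))) :
    ⋃ u ∈ B, constraintCoderiv f C x u = adjointDeriv f x '' (limitingNormalCone C (f x) ∩ B) := by
  ext v
  simp only [constraintCoderiv, mem_iUnion, mem_ofPred_eq, exists_prop, mem_image, mem_inter_iff]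
  constructor
  · rintro ⟨u, hB, hN, rfl⟩
    exact ⟨u, ⟨hN, hB⟩, rfl⟩
  · rintro ⟨u, ⟨hN, hB⟩, rfl⟩
    exact ⟨u, hB, hN, rfl⟩

theorem subregBound_eq_limsup
    {f : EuclideanSpace ℝ (Fin n) → EuclideanSpace ℝ (Fin l)} (hf : ContDiff ℝ 1 f)
    {C : Set (EuclideanSpace ℝ (Fin l))} {x₀ : EuclideanSpace ℝ (Fin n)}
    (hC : SubamenableAt C (f x₀)) :
    subregBound (constraintMap f C) x₀ 0 =
      limsup (fun x =>
        ⨆ v ∈ limitingNormalCone (f ⁻¹' C) x ∩ Metric.closedBall 0 1,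
          ⨅ u ∈ {u | u ∈ limitingNormalCone C (f x) ∧ adjointDeriv f x u = v}, ‖u‖ₑ)
        (𝓝[f ⁻¹' C] x₀) := by
  refine le_antisymm ?_ ?_
  · refine le_of_forall_gt_imp_ge_of_dense fun b hb => ?_
    obtain ⟨κ, hκ, hκb⟩ := ENNReal.lt_iff_exists_nnreal_btwn.1 hb
    -- Two intermediate values: `τ` bounds the multipliers, and the modulus `κ` must exceed it
    -- strictly.
    obtain ⟨τ, hτ, hτκ⟩ := ENNReal.lt_iff_exists_nnreal_btwn.1 hκ
    refine (iInf₂_le κ ?_).trans hκb.le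
    refine isSubregularityModulus_of_multipliers hf hC (ENNReal.coe_lt_coe.1 hτκ) ?_
    filter_upwards [eventually_lt_of_limsup_lt hτ] with x hx v hv
    have hv' := (le_iSup₂ (f := fun v (_ : v ∈ limitingNormalCone (f ⁻¹' C) x ∩
      Metric.closedBall 0 1) => ⨅ u ∈ {u | u ∈ limitingNormalCone C (f x) ∧
        adjointDeriv f x u = v}, ‖u‖ₑ) v hv).trans_lt hx
    obtain ⟨w, ⟨hwN, hwv⟩, hw⟩ := by simpa only [iInf_lt_iff, exists_prop] using hv'
    rw [enorm_lt_coe, ← NNReal.coe_lt_coe, coe_nnnorm] at hw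
    exact ⟨w, hwN, hw.le, hwv⟩
  · refine le_iInf₂ fun κ hκ => limsup_le_of_le (h := ?_)
    filter_upwards [nhdsWithin_le_nhds (eventually_exists_multiplier hf hC hκ)] with x hx
    refine iSup₂_le fun v hv => ?_
    obtain ⟨w, hwN, hw, hwv⟩ := hx v hv.1
    refine iInf₂_le_of_le w ⟨hwN, hwv⟩ ?_
    rw [enorm_le_coe, ← NNReal.coe_le_coe, coe_nnnorm]
    exact hw.trans (mul_le_of_le_one_right κ.coe_nonneg (mem_closedBall_zero_iff.1 hv.2))

end Bounds

theorem corollary3p4 {n l : ℕ}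
    (f : EuclideanSpace ℝ (Fin n) → EuclideanSpace ℝ (Fin l)) (hf : ContDiff ℝ 1 f)
    (C : Set (EuclideanSpace ℝ (Fin l))) (x₀ : EuclideanSpace ℝ (Fin n))
    (hC : SubamenableAt C (f x₀))
    (hF : MetricallySubregularAt (constraintMap f C) x₀ 0) :
    subregBound (constraintMap f C) x₀ 0 =
        limsup (fun x =>
          ⨆ v ∈ limitingNormalCone (f ⁻¹' C) x ∩ Metric.closedBall 0 1,
            ⨅ u ∈ {u | u ∈ limitingNormalCone C (f x) ∧ adjointDeriv f x u = v}, ‖u‖ₑ)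
          (𝓝[f ⁻¹' C] x₀) ∧
      subregBound (constraintMap f C) x₀ 0 =
        limsup (fun x =>
          ⨅ τ ∈ {τ : ℝ≥0 | limitingNormalCone (f ⁻¹' C) x ∩ Metric.closedBall 0 1 ⊆
            (τ : ℝ) • (adjointDeriv f x '' (limitingNormalCone C (f x) ∩ Metric.closedBall 0 1))},
            (τ : ℝ≥0∞))
          (𝓝[f ⁻¹' C] x₀) ∧
      subregBound (constraintMap f C) x₀ 0 =
        limsup (fun x =>
          ⨅ τ ∈ {τ : ℝ≥0 | limitingNormalCone (f ⁻¹' C) x ∩ Metric.closedBall 0 1 ⊆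
            (τ : ℝ) • (⋃ u ∈ Metric.closedBall (0 : EuclideanSpace ℝ (Fin l)) 1,
              constraintCoderiv f C x u)},
            (τ : ℝ≥0∞))
          (𝓝[f ⁻¹' C] x₀) := by
  have h := subregBound_eq_limsup hf hC
  have heq := fun x => iSup_iInf_enorm_eq_iInf_subset
    (limitingNormalCone (f ⁻¹' C) x ∩ Metric.closedBall 0 1) (limitingNormalCone C (f x))
    (fun _ hw _ ht => smul_mem_limitingNormalCone hw ht) (adjointDeriv f x)
  have h' := h
  simp only [heq] at h'
  refine ⟨h, h', ?_⟩
  simp only [iUnion_constraintCoderiv]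
  exact h'
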